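/- For $t\in\mathbb C$ consider the plane curve $$V_t=\{(z_1,z_2)\in\mathbb C^2:\ z_1^4+t\,z_1^2z_2^3+z_2^6=0\}.$$ Two germs at $0$ of subsets $V,W\subset\mathbb C^2$ are called biholomorphic if there are open neighbourhoods $U,U'$ of $0$ in $\mathbb C^2$ and a biholomorphic map $\varphi:U\to U'$ with $\varphi(0)=0$ and $\varphi(U\cap V)=U'\cap W$. Let $r,s\in\mathbb C$. If $r^2=s^2$, then the germs of $V_r$ and $V_s$ at $0$ are biholomorphic. If $r^2\neq 4$ and $s^2\neq 4$, then $$\text{the germs of }V_r\text{ and }V_s\text{ at }0\text{ are biholomorphic}\iff r^2=s^2 .$$ -/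

import Mathlib

/-- The germs at the origin of two subsets `V`, `W` of `ℂᵐ` are biholomorphically equivalent:
there are open neighbourhoods `U = e.source` and `U' = e.target` of the origin and a biholomorphic
map `e : U → U'` with `e 0 = 0` and `e (U ∩ V) = U' ∩ W`. -/
def BiholomorphicGerms {m : ℕ} (V W : Set (Fin m → ℂ)) : Prop :=
  ∃ e : OpenPartialHomeomorph (Fin m → ℂ) (Fin m → ℂ),
    0 ∈ e.source ∧ e 0 = 0 ∧
    DifferentiableOn ℂ e e.source ∧ DifferentiableOn ℂ e.symm e.target ∧
    e '' (e.source ∩ V) = e.target ∩ W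

/-- The plane curve `z₁⁴ + t z₁² z₂³ + z₂⁶ = 0` in `ℂ²`, with coordinates `z₁ = z 0`, `z₂ = z 1`. -/
def planeCurve (t : ℂ) : Set (Fin 2 → ℂ) :=
  {z | z 0 ^ 4 + t * z 0 ^ 2 * z 1 ^ 3 + z 1 ^ 6 = 0}

open Filter Topology Asymptotics

/-! If r² = s², then s = ±r and the scaling z₂ ↦ ±z₂ carries one curve to the other. Conversely, V_r
contains the cusps τ ↦ (aτ³, τ²) with a⁴ + ra² + 1 = 0. Along a cusp a biholomorphism agrees with
its linear part L up to O(τ⁴), so the equation of V_s, quasi-homogeneous of weight 12, sees only the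
diagonal (P, Q) of L (`linear_part_of_cusp_mapsTo`). For r² ≠ 4, a² takes two distinct values;
comparing coefficients gives sQ³ = rP² and Q⁶ = P⁴, hence r² = s². -/

/-- Scaling the second coordinate by a sign `c` as a homeomorphism of `ℂ²`. -/
def signHomeomorph (c : ℂ) (hc : c * c = 1) : (Fin 2 → ℂ) ≃ₜ (Fin 2 → ℂ) where
  toFun z i := ![1, c] i * z i
  invFun z i := ![1, c] i * z i
  left_inv z := by
    funext i
    fin_cases i <;> simp [← mul_assoc, hc]
  right_inv z := by
    funext i
    fin_cases i <;> simp [← mul_assoc, hc]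
  continuous_toFun := by fun_prop
  continuous_invFun := by fun_prop

theorem signHomeomorph_mem_planeCurve {c r : ℂ} (hc : c * c = 1) {z : Fin 2 → ℂ}
    (hz : z ∈ planeCurve r) : signHomeomorph c hc z ∈ planeCurve (c * r) := by
  have hz : z 0 ^ 4 + r * z 0 ^ 2 * z 1 ^ 3 + z 1 ^ 6 = 0 := hz
  change (1 * z 0) ^ 4 + c * r * (1 * z 0) ^ 2 * (c * z 1) ^ 3 + (c * z 1) ^ 6 = 0
  linear_combination hz + (r * z 0 ^ 2 * z 1 ^ 3 * (c ^ 2 + 1) +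
    z 1 ^ 6 * (c ^ 4 + c ^ 2 + 1)) * hc

theorem biholomorphicGerms_planeCurve_of_sign {c r : ℂ} (hc : c * c = 1) :
    BiholomorphicGerms (planeCurve r) (planeCurve (c * r)) := by
  have hd : Differentiable ℂ (fun (z : Fin 2 → ℂ) i => ![1, c] i * z i) := by fun_prop
  refine ⟨(signHomeomorph c hc).toOpenPartialHomeomorph, Set.mem_univ _, ?_, hd.differentiableOn,
    hd.differentiableOn, ?_⟩
  · funext i
    exact mul_zero _
  · ext w
    simp only [Homeomorph.toOpenPartialHomeomorph_source, Set.univ_inter,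
      Homeomorph.toOpenPartialHomeomorph_target, Homeomorph.toOpenPartialHomeomorph_apply]
    constructor
    · rintro ⟨z, hz, rfl⟩
      exact signHomeomorph_mem_planeCurve hc hz
    · intro hw
      refine ⟨signHomeomorph c hc w, ?_, (signHomeomorph c hc).right_inv w⟩
      have h := signHomeomorph_mem_planeCurve hc hw
      rwa [← mul_assoc, hc, one_mul] at h

/-- A holomorphic map agrees with its linearization to second order. -/
theorem isBigO_sub_fderiv_of_differentiableOn {E F : Type*} [NormedAddCommGroup E]
    [NormedSpace ℂ E] [NormedAddCommGroup F] [NormedSpace ℂ F] {f : E → F} {U : Set E}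
    (hU : U ∈ 𝓝 0) (hf : DifferentiableOn ℂ f U) (h0 : f 0 = 0) :
    (fun z => f z - fderiv ℂ f 0 z) =O[𝓝 0] fun z => ‖z‖ ^ 2 := by
  set g : E → F := fun z => f z - fderiv ℂ f 0 z with hg
  have hfd : DifferentiableAt ℂ f 0 := hf.differentiableAt hU
  have hgd : DifferentiableOn ℂ g U := hf.sub (fderiv ℂ f 0).differentiable.differentiableOn
  have hg0 : g 0 = 0 := by simp [hg, h0]
  have hgc : ∀ᶠ z in 𝓝 0, g z ∈ Metric.closedBall (g 0) 1 :=
    (hgd.differentiableAt hU).continuousAt.eventually (Metric.closedBall_mem_nhds _ one_pos)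
  obtain ⟨R, hR, hball⟩ := Metric.mem_nhds_iff.1 (inter_mem hU hgc)
  have hlo : (g · - g 0) =o[𝓝 0] fun w => ‖w - 0‖ ^ 1 := by
    have h := hfd.hasFDerivAt.isLittleO
    simpa [hg, h0] using h.norm_right
  refine IsBigO.of_bound (1 / R ^ 2) ?_
  filter_upwards [Metric.ball_mem_nhds 0 hR] with z hz
  -- Higher-order Schwarz lemma: `g` is o(‖z‖) and bounded by 1 on the ball, so ‖g z‖ ≤ (‖z‖ / R)².
  have h := Complex.dist_le_mul_div_pow_of_mapsTo_ball_of_isLittleO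
    (hgd.mono fun z hz => (hball hz).1) (fun z hz => (hball hz).2) hlo hz
  rw [hg0, dist_zero_right, dist_zero_right, div_pow] at h
  simpa [div_eq_inv_mul] using h

/-- The linear part `L` of a holomorphic map that sends the cusp `τ ↦ (a τ³, τ²)` into the curve
`planeCurve s` is lower triangular, and its diagonal maps `(a, 1)` into the same curve. -/
theorem linear_part_of_cusp_mapsTo {f : (Fin 2 → ℂ) → (Fin 2 → ℂ)}
    {L : (Fin 2 → ℂ) →L[ℂ] (Fin 2 → ℂ)} {a s : ℂ}
    (hf : (fun z => f z - L z) =O[𝓝 0] fun z => ‖z‖ ^ 2)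
    (hs : ∀ᶠ τ : ℂ in 𝓝 0, f ![a * τ ^ 3, τ ^ 2] ∈ planeCurve s) :
    L ![0, 1] 0 = 0 ∧
      (L ![1, 0] 0 * a) ^ 4 + s * (L ![1, 0] 0 * a) ^ 2 * L ![0, 1] 1 ^ 3 + L ![0, 1] 1 ^ 6 = 0 := by
  set γ : ℂ → Fin 2 → ℂ := fun τ => ![a * τ ^ 3, τ ^ 2] with hγ
  have hγc : Tendsto γ (𝓝 0) (𝓝 0) := by
    have : Continuous γ := by fun_prop
    have h0 : γ 0 = 0 := by
      funext i
      fin_cases i <;> simp [hγ]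
    simpa only [h0] using this.tendsto 0
  have hγO : γ =O[𝓝 0] fun τ => τ ^ 2 := by
    refine isBigO_pi.2 fun i => ?_
    fin_cases i
    · have h : (fun τ : ℂ => τ ^ 3) =O[𝓝 0] fun τ : ℂ => τ ^ 2 :=
        (isLittleO_pow_pow (by norm_num)).isBigO
      simpa [hγ] using h.const_mul_left a
    · simpa [hγ] using isBigO_refl (fun τ : ℂ => τ ^ 2) (𝓝 0)
  have hL (τ : ℂ) (i : Fin 2) : L (γ τ) i = L ![1, 0] i * a * τ ^ 3 + L ![0, 1] i * τ ^ 2 := by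
    have : γ τ = (a * τ ^ 3) • ![1, 0] + (τ ^ 2) • ![0, 1] := by
      funext i
      fin_cases i <;> simp [hγ]
    rw [this, map_add, map_smul, map_smul]
    simp only [Pi.add_apply, Pi.smul_apply, smul_eq_mul]
    ring
  have hrem (i : Fin 2) : (fun τ => f (γ τ) i - L (γ τ) i) =O[𝓝 0] fun τ => τ ^ 4 := by
    have h1 := (hf.comp_tendsto hγc).trans ((hγO.norm_left.pow 2))
    have h2 := isBigO_pi.1 h1 i
    simpa [Function.comp_def, ← pow_mul] using h2
  have hlim {k : ℕ} (hk : k < 4) (i : Fin 2) :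
      Tendsto (fun τ => (f (γ τ) i - L (γ τ) i) / τ ^ k) (𝓝[≠] 0) (𝓝 0) :=
    (((hrem i).trans_isLittleO (isLittleO_pow_pow hk)).mono nhdsWithin_le_nhds).tendsto_div_nhds_zero
  have hid : Tendsto (fun τ : ℂ => τ) (𝓝[≠] 0) (𝓝 0) := tendsto_nhdsWithin_of_tendsto_nhds tendsto_id
  have hne : ∀ᶠ τ : ℂ in 𝓝[≠] 0, τ ≠ 0 := self_mem_nhdsWithin
  have hs' := hs.filter_mono (nhdsWithin_le_nhds (s := {0}ᶜ))
  have h2 (i : Fin 2) : Tendsto (fun τ => f (γ τ) i / τ ^ 2) (𝓝[≠] 0) (𝓝 (L ![0, 1] i)) := by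
    have h := (hlim (k := 2) (by norm_num) i).add ((hid.const_mul (L ![1, 0] i * a)).add_const
      (L ![0, 1] i))
    simp only [mul_zero, zero_add] at h
    refine h.congr' ?_
    filter_upwards [hne] with τ hτ
    rw [hL]
    field_simp
    ring
  have h01 : L ![0, 1] 0 = 0 := by
    -- Divide the equation by τ⁸: only the z₁⁴ term survives in the limit.
    have h := ((h2 0).pow 4).add ((((hid.pow 2).const_mul s).mul (((h2 0).pow 2).mul
      ((h2 1).pow 3))).add ((hid.pow 4).mul ((h2 1).pow 6)))
    have hz : Tendsto (fun _ : ℂ => (0 : ℂ)) (𝓝[≠] (0 : ℂ)) (𝓝 0) := tendsto_const_nhds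
    have := tendsto_nhds_unique (h.congr' ?_) hz
    · simpa using this
    · filter_upwards [hne, hs'] with τ hτ hmem
      have hmem : f (γ τ) 0 ^ 4 + s * f (γ τ) 0 ^ 2 * f (γ τ) 1 ^ 3 + f (γ τ) 1 ^ 6 = 0 := hmem
      field_simp
      linear_combination hmem
  refine ⟨h01, ?_⟩
  have h3 : Tendsto (fun τ => f (γ τ) 0 / τ ^ 3) (𝓝[≠] 0) (𝓝 (L ![1, 0] 0 * a)) := by
    have h := (hlim (k := 3) (by norm_num) 0).add_const (L ![1, 0] 0 * a)
    rw [zero_add] at h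
    refine h.congr' ?_
    filter_upwards [hne] with τ hτ
    rw [hL, h01]
    field_simp
    ring
  -- Now z₁ has order at least 3, so all three terms survive division by τ¹².
  have h := ((h3.pow 4).add (((h3.pow 2).const_mul s).mul ((h2 1).pow 3))).add ((h2 1).pow 6)
  refine tendsto_nhds_unique (h.congr' ?_) tendsto_const_nhds
  filter_upwards [hne, hs'] with τ hτ hmem
  have hmem : f (γ τ) 0 ^ 4 + s * f (γ τ) 0 ^ 2 * f (γ τ) 1 ^ 3 + f (γ τ) 1 ^ 6 = 0 := hmem
  field_simp
  linear_combination hmem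

theorem fderiv_injective_of_openPartialHomeomorph {m : ℕ}
    {e : OpenPartialHomeomorph (Fin m → ℂ) (Fin m → ℂ)} (h0 : 0 ∈ e.source)
    (hd : DifferentiableOn ℂ e e.source) (hds : DifferentiableOn ℂ e.symm e.target) :
    Function.Injective (fderiv ℂ e 0) := by
  have hes : e.source ∈ 𝓝 0 := e.open_source.mem_nhds h0
  have h0t : e 0 ∈ e.target := e.map_source h0
  have h1 := (hd.differentiableAt hes).hasFDerivAt
  have h2 := (hds.differentiableAt (e.open_target.mem_nhds h0t)).hasFDerivAt
  have h3 := (h2.comp 0 h1).unique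
    ((hasFDerivAt_id (𝕜 := ℂ) 0).congr_of_eventuallyEq (e.eventually_left_inverse h0))
  exact Function.LeftInverse.injective (g := fderiv ℂ e.symm (e 0)) fun v =>
    DFunLike.congr_fun h3 v

theorem sq_eq_sq_of_biholomorphicGerms {r s : ℂ} (hr : r ^ 2 ≠ 4)
    (h : BiholomorphicGerms (planeCurve r) (planeCurve s)) : r ^ 2 = s ^ 2 := by
  obtain ⟨e, h0, he0, hd, hds, himg⟩ := h
  have hes : e.source ∈ 𝓝 0 := e.open_source.mem_nhds h0
  set L := fderiv ℂ e 0
  have hinj : Function.Injective L := fderiv_injective_of_openPartialHomeomorph h0 hd hds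
  have key (a : ℂ) (ha : a ^ 4 + r * a ^ 2 + 1 = 0) : L ![0, 1] 0 = 0 ∧
      (L ![1, 0] 0 * a) ^ 4 + s * (L ![1, 0] 0 * a) ^ 2 * L ![0, 1] 1 ^ 3 +
        L ![0, 1] 1 ^ 6 = 0 := by
    refine linear_part_of_cusp_mapsTo (a := a) (s := s)
      (isBigO_sub_fderiv_of_differentiableOn hes hd he0) ?_
    have hc : ContinuousAt (fun τ : ℂ => (![a * τ ^ 3, τ ^ 2] : Fin 2 → ℂ)) 0 := by fun_prop
    have h00 : (![a * 0 ^ 3, 0 ^ 2] : Fin 2 → ℂ) = 0 := by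
      funext i
      fin_cases i <;> simp
    filter_upwards [hc.preimage_mem_nhds (by rwa [h00])] with τ hτ
    refine (himg.subset (Set.mem_image_of_mem e ⟨hτ, ?_⟩)).2
    simp only [planeCurve, Set.mem_ofPred_eq, Matrix.cons_val_zero, Matrix.cons_val_one]
    linear_combination τ ^ 12 * ha
  -- The roots of A² + rA + 1 are (-r ± d)/2, and a², b² are these roots.
  obtain ⟨d, hdsq⟩ := IsAlgClosed.exists_pow_nat_eq (r ^ 2 - 4) (n := 2) (by norm_num)
  obtain ⟨a, ha⟩ := IsAlgClosed.exists_pow_nat_eq ((-r + d) / 2) (n := 2) (by norm_num)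
  obtain ⟨b, hb⟩ := IsAlgClosed.exists_pow_nat_eq ((-r - d) / 2) (n := 2) (by norm_num)
  have hd0 : d ≠ 0 := by
    rintro rfl
    exact hr (by linear_combination -hdsq)
  obtain ⟨h01, hA⟩ := key a (by
    linear_combination (a ^ 2 + (-r + d) / 2 + r) * ha + hdsq / 4)
  obtain ⟨-, hB⟩ := key b (by
    linear_combination (b ^ 2 + (-r - d) / 2 + r) * hb + hdsq / 4)
  have hQ : L ![0, 1] 1 ≠ 0 := by
    intro hQ
    have h : L ![0, 1] = L 0 := by
      rw [map_zero]
      funext i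
      fin_cases i
      · exact h01
      · exact hQ
    simpa using congrFun (hinj h) 1
  have hP : L ![1, 0] 0 ≠ 0 := by
    intro hP
    have h : L (L ![0, 1] 1 • ![1, 0]) = L (L ![1, 0] 1 • ![0, 1]) := by
      rw [map_smul, map_smul]
      funext i
      fin_cases i
      · simp [hP, h01]
      · simp [mul_comm]
    have := congrFun (hinj h) 0
    exact hQ (by simpa using this)
  generalize L ![1, 0] 0 = P at *
  generalize L ![0, 1] 1 = Q at *
  have hA' : P ^ 4 * ((-r + d) / 2) ^ 2 + s * P ^ 2 * ((-r + d) / 2) * Q ^ 3 + Q ^ 6 = 0 := by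
    rw [← ha]
    linear_combination hA
  have hB' : P ^ 4 * ((-r - d) / 2) ^ 2 + s * P ^ 2 * ((-r - d) / 2) * Q ^ 3 + Q ^ 6 = 0 := by
    rw [← hb]
    linear_combination hB
  -- Subtract the two equations and cancel the root difference d.
  have h1 : s * Q ^ 3 = r * P ^ 2 := by
    refine mul_left_cancel₀ (mul_ne_zero hd0 (pow_ne_zero 2 hP)) ?_
    linear_combination hA' - hB'
  have h2 : Q ^ 6 = P ^ 4 := by
    linear_combination hA' + P ^ 4 * hdsq / (-4) - P ^ 2 * ((-r + d) / 2) * h1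
  refine mul_right_cancel₀ (pow_ne_zero 4 hP) ?_
  linear_combination -(s * Q ^ 3 + r * P ^ 2) * h1 + s ^ 2 * h2

theorem mainTheorem10 (r s : ℂ) :
    (r ^ 2 = s ^ 2 → BiholomorphicGerms (planeCurve r) (planeCurve s)) ∧
    (r ^ 2 ≠ 4 → s ^ 2 ≠ 4 →
      (BiholomorphicGerms (planeCurve r) (planeCurve s) ↔ r ^ 2 = s ^ 2)) := by
  have hmpr (h : r ^ 2 = s ^ 2) : BiholomorphicGerms (planeCurve r) (planeCurve s) := by
    rcases sq_eq_sq_iff_eq_or_eq_neg.1 h.symm with rfl | rfl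
    · simpa using biholomorphicGerms_planeCurve_of_sign (c := 1) (r := s) (by norm_num)
    · simpa using biholomorphicGerms_planeCurve_of_sign (c := -1) (r := r) (by norm_num)
  exact ⟨hmpr, fun hr _ => ⟨sq_eq_sq_of_biholomorphicGerms hr, hmpr⟩⟩
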